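/- Let $p,t\ge 1$ be integers, let $X$ be a finite set partitioned into $X_1,\dots,X_p$, and put $n_i=|X_i|$. For a tuple $(r_1,\dots,r_p)$ of positive integers let $$\binom{X_1,\dots,X_p}{r_1,\dots,r_p}=\{F\subseteq X: |F\cap X_i|=r_i,\ i=1,\dots,p\}.$$ Let $\mathcal R$ be a non-empty finite set of $p$-tuples of positive integers, let $b$ and $c$ be the largest and the smallest number occurring as an entry of some tuple in $\mathcal R$, and put $$\mathcal H_2=\bigcup_{(r_1,\dots,r_p)\in\mathcal R}\binom{X_1,\dots,X_p}{r_1,\dots,r_p}.$$ A family $\mathcal F$ of subsets of $X$ is $t$-intersecting if $|A\cap B|\ge t$ for all $A,B\in\mathcal F$; it is trivial if all its members contain a fixed $t$-subset of $X$. **Theorem 1.4.** Suppose $t\le c$ and $n_i>2(t+1)p\,b^{t+2}$ for every $i\in\{1,\dots,p\}$. Then every $t$-intersecting subfamily $\mathcal F\subseteq\mathcal H_2$ of maximum size is trivial, and in fact is a full $t$-star in $\mathcal H_2$: $\mathcal F=\{F\in\mathcal H_2: T\subseteq F\}$ for some $t$-subset $T$ of $X$. -/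

import Mathlib

/-- The sets `X 0, …, X (p - 1)` partition the ground set `V`. -/
def IsPartitionInto {V : Type*} {p : ℕ} (X : Fin p → Finset V) : Prop :=
  (∀ i j, i ≠ j → Disjoint (X i) (X j)) ∧ ∀ v, ∃ i, v ∈ X i

/-- The direct product of the `r i`-subsets of the parts `X i`: all subsets `F` of the ground set
with `|F ∩ X i| = r i` for every `i`. When the `X i` partition the ground set, such an `F`
automatically has `∑ i, r i` elements. -/
def directProduct {V : Type*} [Fintype V] [DecidableEq V] {p : ℕ}
    (X : Fin p → Finset V) (r : Fin p → ℕ) : Finset (Finset V) :=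
  Finset.univ.filter fun F => ∀ i, (F ∩ X i).card = r i

/-- Katona's family: the union over `r ∈ R` of the direct products with parameters `r`. -/
def katonaFamily {V : Type*} [Fintype V] [DecidableEq V] {p : ℕ}
    (X : Fin p → Finset V) (R : Finset (Fin p → ℕ)) : Finset (Finset V) :=
  R.biUnion (directProduct X)

/-- The set of all numbers which appear as an entry of some tuple in `R`. -/
def entries {p : ℕ} (R : Finset (Fin p → ℕ)) : Set ℕ :=
  {m | ∃ r ∈ R, ∃ i, r i = m}

/-- Any two (possibly equal) members meet in at least `t` elements. -/
def IsTIntersecting {V : Type*} [DecidableEq V] (t : ℕ) (F : Finset (Finset V)) : Prop :=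
  ∀ A ∈ F, ∀ B ∈ F, t ≤ (A ∩ B).card

/-- `F` is a `t`-intersecting subfamily of `H` of the maximum size. -/
def IsLargestTIntersecting {V : Type*} [DecidableEq V] (t : ℕ) (H F : Finset (Finset V)) : Prop :=
  F ⊆ H ∧ IsTIntersecting t F ∧
    ∀ G : Finset (Finset V), G ⊆ H → IsTIntersecting t G → G.card ≤ F.card

/-- All members of `F` contain a fixed `t`-subset of the ground set. -/
def IsTrivialFamily {V : Type*} (t : ℕ) (F : Finset (Finset V)) : Prop :=
  ∃ T : Finset V, T.card = t ∧ ∀ A ∈ F, T ⊆ A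

/-- `F` consists of all the members of `H` which contain a fixed `t`-subset of the ground set. -/
def IsFullStar {V : Type*} [DecidableEq V] (t : ℕ) (H F : Finset (Finset V)) : Prop :=
  ∃ T : Finset V, T.card = t ∧ F = H.filter fun A => T ⊆ A

/-!
Write `H` for Katona's family, let `n` be the size of the smallest part, and call the set of all
members of `H` containing `W` the star of `W`.

*Shifting.* Fix an order on the ground set. Replacing a later element of a part by an earlier one
of the same part (a `UV.compression` along two singletons) maps `H` to itself and preserves being a
largest `t`-intersecting subfamily, and it lowers the sum of all positions of all
elements of the members whenever it changes the family (`totalWeight_compression_lt`).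
It also creates no stars (`isFullStar_of_compression`): if the compressed family is the star of `T`,
then the members of the original one contain `T` or its exchange `T'`; if both really occurred, in
`B` (not containing `T`) and `A` (not containing `T'`), then a member `C ⊇ T` of `H` meeting
`A ∪ B` only in `T` would give a pair with an intersection of size `t - 1`. So one may assume that
`F` is shifted.

*Shifted families.* Let `Y` consist of the first `2b` elements of every part. Any two members of a
shifted `F` meet in `t` elements of `Y` (`le_card_inter_inter_head`). Choose `A ∈ F` with
`|A ∩ Y| = t + j` minimal. If `j = 0`, all members contain the `t`-set `A ∩ Y`. If `j > 0`, every
member contains a `(t + j)`-subset of `Y` with at least `t` elements in `A`, and there are at most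
`C(t + j, t) C(2bp, j) ≤ ((t + 1) 2bp) ^ j` of these. By double counting and symmetry within the
parts, the star of an `m`-set has at most `(b / n) ^ m |H|` members
(`pow_mul_card_fullStar_le`), whereas that of a `t`-subset of the smallest part has at least
`|H| / n ^ t`, since each member has at least `t` elements there (`card_katonaFamily_le`). As `F` is
largest, `n ^ j ≤ (2 (t + 1) p b ^ 2) ^ j b ^ t`, which contradicts `n > 2 (t + 1) p b ^ (t + 2)`.
-/

open Finset

/-! ### Exchanges and extensions in Katona's family -/

/-- Exchanging an element for another one of the same part preserves the profile of a set. -/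
lemma card_exchange_inter {V : Type*} [DecidableEq V] {p : ℕ} {X : Fin p → Finset V}
    (hX : IsPartitionInto X) {A : Finset V} {x y : V} {i : Fin p} (hx : x ∈ X i) (hy : y ∈ X i)
    (hyA : y ∈ A) (hxA : x ∉ A) (j : Fin p) :
    #(insert x (A.erase y) ∩ X j) = #(A ∩ X j) := by
  by_cases hij : i = j
  · subst hij
    have h : insert x (A.erase y) ∩ X i = insert x ((A ∩ X i).erase y) := by
      ext v; simp only [mem_inter, mem_insert, mem_erase]; grind
    have h1 : x ∉ (A ∩ X i).erase y := by simp [hxA]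
    have h2 : y ∈ A ∩ X i := by simp [hyA, hy]
    rw [h, card_insert_of_notMem h1, card_erase_add_one h2]
  · have hd := Finset.disjoint_left.1 (hX.1 i j hij)
    congr 1
    ext v; simp only [mem_inter, mem_insert, mem_erase]; grind

section KatonaFamily

variable {V : Type*} [Fintype V] [DecidableEq V] {p : ℕ} {X : Fin p → Finset V}
  {R : Finset (Fin p → ℕ)}

lemma mem_katonaFamily {A : Finset V} :
    A ∈ katonaFamily X R ↔ (fun i => #(A ∩ X i)) ∈ R := by
  simp only [katonaFamily, directProduct, mem_biUnion, mem_filter, mem_univ, true_and]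
  constructor
  · rintro ⟨r, hr, h⟩
    rwa [funext h]
  · intro h
    exact ⟨_, h, fun _ => rfl⟩

lemma exchange_mem_katonaFamily (hX : IsPartitionInto X) {A : Finset V} {x y : V} {i : Fin p}
    (hx : x ∈ X i) (hy : y ∈ X i) (hyA : y ∈ A) (hxA : x ∉ A) (hA : A ∈ katonaFamily X R) :
    insert x (A.erase y) ∈ katonaFamily X R := by
  rw [mem_katonaFamily] at hA ⊢
  simpa only [card_exchange_inter hX hx hy hyA hxA] using hA

/-- A set `T` extends to a member of the family that meets a given set `U` only inside `T`, as soon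
as every part has room for it. -/
lemma exists_mem_katonaFamily_superset (hX : IsPartitionInto X) {r : Fin p → ℕ} (hr : r ∈ R)
    {T U : Finset V} (hT : ∀ i, #(T ∩ X i) ≤ r i) (hU : ∀ i, #(U ∩ X i) + r i ≤ #(X i)) :
    ∃ C ∈ katonaFamily X R, T ⊆ C ∧ C ∩ U ⊆ T := by
  have key : ∀ i, ∃ D, T ∩ X i ⊆ D ∧ D ⊆ (X i \ U) ∪ (T ∩ X i) ∧ #D = r i := by
    intro i
    apply Finset.exists_subsuperset_card_eq subset_union_right (hT i)
    have h1 := card_le_card (subset_union_left : X i \ U ⊆ (X i \ U) ∪ (T ∩ X i))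
    have h2 := card_sdiff_add_card_inter (X i) U
    rw [inter_comm] at h2
    have := hU i
    omega
  choose D hTD hD hDr using key
  have hDX : ∀ i, D i ⊆ X i := fun i v hv => by
    have := hD i hv
    simp only [mem_union, mem_sdiff, mem_inter] at this
    tauto
  have hC : ∀ i, univ.biUnion D ∩ X i = D i := by
    intro i
    ext v
    simp only [mem_inter, mem_biUnion, mem_univ, true_and]
    constructor
    · rintro ⟨⟨j, hj⟩, hv⟩
      by_cases hij : j = i
      · exact hij ▸ hj
      · exact absurd hv (Finset.disjoint_left.1 (hX.1 j i hij) (hDX j hj))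
    · exact fun hv => ⟨⟨i, hv⟩, hDX i hv⟩
  refine ⟨univ.biUnion D, ?_, ?_, ?_⟩
  · rw [mem_katonaFamily]
    simp only [hC, hDr]
    exact hr
  · intro v hv
    obtain ⟨i, hi⟩ := hX.2 v
    exact mem_biUnion.2 ⟨i, mem_univ i, hTD i (mem_inter.2 ⟨hv, hi⟩)⟩
  · intro v hv
    obtain ⟨hv, hvU⟩ := mem_inter.1 hv
    obtain ⟨i, -, hi⟩ := mem_biUnion.1 hv
    have := hD i hi
    simp only [mem_union, mem_sdiff, mem_inter] at this
    tauto

end KatonaFamily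

/-! ### Stars -/

section Star

variable {V : Type*} [DecidableEq V]

/-- The full star of `W` in `H`: all members of `H` which contain `W`. -/
def fullStar (H : Finset (Finset V)) (W : Finset V) : Finset (Finset V) :=
  H.filter fun A => W ⊆ A

lemma mem_fullStar {H : Finset (Finset V)} {W A : Finset V} :
    A ∈ fullStar H W ↔ A ∈ H ∧ W ⊆ A := by simp [fullStar]

lemma isTIntersecting_fullStar (H : Finset (Finset V)) (T : Finset V) :
    IsTIntersecting #T (fullStar H T) := fun _ hA _ hB =>
  card_le_card (subset_inter (mem_fullStar.1 hA).2 (mem_fullStar.1 hB).2)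

/-- A largest `t`-intersecting family all of whose members contain a fixed `t`-set `T` is the full
star of `T`. -/
lemma IsLargestTIntersecting.eq_fullStar {t : ℕ} {H F : Finset (Finset V)}
    (hF : IsLargestTIntersecting t H F) {T : Finset V} (hT : #T = t) (h : ∀ A ∈ F, T ⊆ A) :
    F = fullStar H T :=
  eq_of_subset_of_card_le (fun A hA => mem_fullStar.2 ⟨hF.1 hA, h A hA⟩)
    (hF.2.2 _ (filter_subset _ _) (hT ▸ isTIntersecting_fullStar H T))

/-- Double counting the pairs of a member `A ⊇ W` of `H` and an element of `(A ∩ X) \ W`. -/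
lemma sum_card_fullStar_insert (H : Finset (Finset V)) (W Y : Finset V) :
    ∑ y ∈ Y \ W, #(fullStar H (insert y W)) = ∑ A ∈ fullStar H W, #((A ∩ Y) \ W) := by
  have h := Finset.sum_card_bipartiteAbove_eq_sum_card_bipartiteBelow
    (s := Y \ W) (t := fullStar H W) (fun y A => y ∈ A)
  have h1 : ∀ y ∈ Y \ W, #(bipartiteAbove (fun y A => y ∈ A) (fullStar H W) y)
      = #(fullStar H (insert y W)) := by
    intro y hy
    congr 1
    ext A
    simp only [mem_bipartiteAbove, mem_fullStar, insert_subset_iff]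
    tauto
  have h2 : ∀ A ∈ fullStar H W, #(bipartiteBelow (fun y A => y ∈ A) (Y \ W) A)
      = #((A ∩ Y) \ W) := by
    intro A hA
    congr 1
    ext v
    simp only [mem_bipartiteBelow, mem_sdiff, mem_inter]
    tauto
  rw [← sum_congr rfl h1, ← sum_congr rfl h2, h]

end Star

/-! ### Sizes of stars in Katona's family -/

section StarSize

variable {V : Type*} [Fintype V] [DecidableEq V] {p : ℕ} {X : Fin p → Finset V}
  {R : Finset (Fin p → ℕ)}

lemma card_fullStar_le_of_exchange (hX : IsPartitionInto X) {W : Finset V} {x y : V} {i : Fin p}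
    (hx : x ∈ X i) (hy : y ∈ X i) (hxW : x ∉ W) (hyW : y ∉ W) :
    #(fullStar (katonaFamily X R) (insert x W)) ≤ #(fullStar (katonaFamily X R) (insert y W)) := by
  apply card_le_card_of_injOn (fun A => A.image (Equiv.swap x y))
  · intro A hA
    simp only [mem_coe, mem_fullStar, insert_subset_iff] at hA ⊢
    obtain ⟨hA, hxA, hWA⟩ := hA
    have hW : ∀ v ∈ W, Equiv.swap x y v = v := fun v hv =>
      Equiv.swap_apply_of_ne_of_ne (by grind) (by grind)
    refine ⟨?_, ?_, ?_⟩
    · by_cases hyA : y ∈ A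
      · have : A.image (Equiv.swap x y) = A := by
          ext v; simp only [mem_image, Equiv.swap_apply_def]; grind
        rwa [this]
      · have : A.image (Equiv.swap x y) = insert y (A.erase x) := by
          ext v; simp only [mem_image, mem_insert, mem_erase, Equiv.swap_apply_def]; grind
        rw [this]
        exact exchange_mem_katonaFamily hX hy hx hxA hyA hA
    · exact mem_image.2 ⟨x, hxA, Equiv.swap_apply_left x y⟩
    · exact fun v hv => mem_image.2 ⟨v, hWA hv, hW v hv⟩
  · exact (image_injective (Equiv.swap x y).injective).injOn

lemma card_fullStar_eq_of_exchange (hX : IsPartitionInto X) {W : Finset V} {x y : V} {i : Fin p}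
    (hx : x ∈ X i) (hy : y ∈ X i) (hxW : x ∉ W) (hyW : y ∉ W) :
    #(fullStar (katonaFamily X R) (insert x W)) = #(fullStar (katonaFamily X R) (insert y W)) :=
  (card_fullStar_le_of_exchange hX hx hy hxW hyW).antisymm
    (card_fullStar_le_of_exchange hX hy hx hyW hxW)

/-- By symmetry inside the part `X i`, all summands of `sum_card_fullStar_insert` agree. -/
lemma card_sdiff_mul_card_fullStar_insert (hX : IsPartitionInto X) {W : Finset V} {x : V}
    {i : Fin p} (hx : x ∈ X i) (hxW : x ∉ W) :
    #(X i \ W) * #(fullStar (katonaFamily X R) (insert x W)) =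
      ∑ A ∈ fullStar (katonaFamily X R) W, #((A ∩ X i) \ W) := by
  rw [← sum_card_fullStar_insert, ← smul_eq_mul, ← sum_const]
  refine sum_congr rfl fun y hy => ?_
  rw [mem_sdiff] at hy
  exact card_fullStar_eq_of_exchange hX hx hy.1 hxW hy.2

/-- One more prescribed element of `X i` shrinks a star at least by the factor `b / |X i|`. -/
lemma card_mul_card_fullStar_insert_le (hX : IsPartitionInto X) {b : ℕ}
    (hb : ∀ r ∈ R, ∀ i, r i ≤ b) {W : Finset V} {x : V} {i : Fin p} (hx : x ∈ X i)
    (hxW : x ∉ W) (hbX : b ≤ #(X i)) :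
    #(X i) * #(fullStar (katonaFamily X R) (insert x W)) ≤
      b * #(fullStar (katonaFamily X R) W) := by
  have h := card_sdiff_mul_card_fullStar_insert (R := R) hX hx hxW
  obtain hS | ⟨A, hA⟩ := (fullStar (katonaFamily X R) W).eq_empty_or_nonempty
  · have : #(X i \ W) ≠ 0 := card_ne_zero.2 ⟨x, mem_sdiff.2 ⟨hx, hxW⟩⟩
    rw [hS, sum_empty, mul_eq_zero] at h
    simp [h.resolve_left this]
  · have hcard : ∀ B ∈ fullStar (katonaFamily X R) W, #(B ∩ X i) ≤ b := fun B hB =>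
      hb _ (mem_katonaFamily.1 (mem_fullStar.1 hB).1) i
    have hw : ∀ B ∈ fullStar (katonaFamily X R) W,
        #((B ∩ X i) \ W) + #(W ∩ X i) = #(B ∩ X i) := by
      intro B hB
      have := card_sdiff_add_card_inter (B ∩ X i) W
      rwa [show (B ∩ X i) ∩ W = W ∩ X i by
        ext v; have := (mem_fullStar.1 hB).2; simp only [mem_inter]; grind] at this
    have hwX := card_sdiff_add_card_inter (X i) W
    rw [inter_comm] at hwX
    have hle : #(X i \ W) * #(fullStar (katonaFamily X R) (insert x W)) ≤
        #(fullStar (katonaFamily X R) W) * (b - #(W ∩ X i)) := by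
      rw [h, ← smul_eq_mul]
      apply sum_le_card_nsmul
      intro B hB
      have := hcard B hB; have := hw B hB
      omega
    have hwb : #(W ∩ X i) ≤ b := by have := hcard A hA; have := hw A hA; omega
    obtain ⟨d, hd⟩ := Nat.exists_eq_add_of_le hwb
    obtain ⟨e, he⟩ := Nat.exists_eq_add_of_le hbX
    have hm : #(X i \ W) = d + e := by omega
    rw [hm, hd, Nat.add_sub_cancel_left] at hle
    rw [he, hd]
    generalize #(W ∩ X i) = w at *
    generalize #(fullStar (katonaFamily X R) (insert x W)) = s' at *
    generalize #(fullStar (katonaFamily X R) W) = s at *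
    -- The goal `(w + d + e) * s' ≤ (w + d) * s` is the sum of `hle` and `w * s' ≤ w * s`.
    have hde : 0 < d + e := by
      rw [← hm]; exact card_pos.2 ⟨x, mem_sdiff.2 ⟨hx, hxW⟩⟩
    have hs : s' ≤ s := by
      have : (d + e) * s' ≤ (d + e) * s := hle.trans (by nlinarith [Nat.zero_le (e * s)])
      exact Nat.le_of_mul_le_mul_left this hde
    nlinarith [Nat.mul_le_mul_left w hs]

lemma pow_mul_card_fullStar_le (hX : IsPartitionInto X) {b n : ℕ}
    (hb : ∀ r ∈ R, ∀ i, r i ≤ b) (hbX : ∀ i, b ≤ #(X i)) (hn : ∀ i, n ≤ #(X i)) (W : Finset V) :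
    n ^ #W * #(fullStar (katonaFamily X R) W) ≤ b ^ #W * #(katonaFamily X R) := by
  induction W using Finset.induction_on with
  | empty => simp [fullStar]
  | insert x W hxW ih =>
    obtain ⟨i, hi⟩ := hX.2 x
    rw [card_insert_of_notMem hxW]
    calc n ^ (#W + 1) * #(fullStar (katonaFamily X R) (insert x W))
        = n ^ #W * (n * #(fullStar (katonaFamily X R) (insert x W))) := by ring
      _ ≤ n ^ #W * (b * #(fullStar (katonaFamily X R) W)) := by
        exact Nat.mul_le_mul_left _ ((Nat.mul_le_mul_right _ (hn i)).trans
          (card_mul_card_fullStar_insert_le hX hb hi hxW (hbX i)))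
      _ = b * (n ^ #W * #(fullStar (katonaFamily X R) W)) := by ring
      _ ≤ b * (b ^ #W * #(katonaFamily X R)) := by gcongr
      _ = b ^ (#W + 1) * #(katonaFamily X R) := by ring

/-- The star of a set of at most `c` elements of a single part is large, because every member of
the family has at least `c` elements in that part. -/
lemma card_katonaFamily_le (hX : IsPartitionInto X) {c : ℕ}
    (hc : ∀ r ∈ R, ∀ i, c ≤ r i) {i : Fin p} {T : Finset V} (hT : T ⊆ X i) (hTc : #T ≤ c) :
    #(katonaFamily X R) ≤ #(X i) ^ #T * #(fullStar (katonaFamily X R) T) := by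
  induction T using Finset.induction_on with
  | empty => simp [fullStar]
  | insert x T hxT ih =>
    rw [card_insert_of_notMem hxT] at hTc ⊢
    rw [insert_subset_iff] at hT
    refine (ih hT.2 (by omega)).trans ?_
    rw [pow_succ, mul_assoc]
    gcongr
    refine le_trans ?_ (Nat.mul_le_mul_right _ (card_le_card (sdiff_subset : X i \ T ⊆ X i)))
    rw [card_sdiff_mul_card_fullStar_insert hX hT.1 hxT, card_eq_sum_ones]
    refine sum_le_sum fun A hA => ?_
    have h1 : c ≤ #(A ∩ X i) := hc _ (mem_katonaFamily.1 (mem_fullStar.1 hA).1) i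
    have h2 := le_card_sdiff T (A ∩ X i)
    omega

end StarSize

/-! ### Compression -/

section Compression

variable {V : Type*} [DecidableEq V]

lemma mem_compression_singleton {F : Finset (Finset V)} {x y : V} {A : Finset V} :
    A ∈ UV.compression {x} {y} F ↔
      (A ∈ F ∧ (x ∉ A → y ∈ A → insert x (A.erase y) ∈ F)) ∨
        (A ∉ F ∧ x ∈ A ∧ y ∉ A ∧ insert y (A.erase x) ∈ F) := by
  have hc : ∀ B : Finset V, UV.compress {x} {y} B =
      if x ∉ B ∧ y ∈ B then insert x (B.erase y) else B := by
    intro B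
    unfold UV.compress
    simp only [disjoint_singleton_left, singleton_subset_iff, sup_eq_union]
    split_ifs with h
    · ext v; simp only [mem_sdiff, mem_union, mem_singleton, mem_insert, mem_erase]; grind
    · rfl
  rw [UV.mem_compression]
  simp only [hc]
  constructor
  · rintro (⟨hA, h⟩ | ⟨hA, B, hB, h⟩)
    · left
      refine ⟨hA, fun hx hy => ?_⟩
      rwa [if_pos ⟨hx, hy⟩] at h
    · right
      split_ifs at h with hxy
      · subst h
        have hne : x ≠ y := fun h => hxy.1 (h ▸ hxy.2)
        refine ⟨hA, mem_insert_self _ _, by simp [hne.symm], ?_⟩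
        have : insert y ((insert x (B.erase y)).erase x) = B := by
          ext v; simp only [mem_insert, mem_erase]; grind
        rwa [this]
      · exact absurd (h ▸ hB) hA
  · rintro (⟨hA, h⟩ | ⟨hA, hx, hy, h⟩)
    · left
      refine ⟨hA, ?_⟩
      split_ifs with hxy
      · exact h hxy.1 hxy.2
      · exact hA
    · right
      have hne : x ≠ y := fun h => hy (h ▸ hx)
      refine ⟨hA, _, h, ?_⟩
      rw [if_pos (by simp [hne])]
      ext v; simp only [mem_insert, mem_erase]; grind

lemma IsTIntersecting.compression {t : ℕ} {F : Finset (Finset V)} (hF : IsTIntersecting t F)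
    (x y : V) : IsTIntersecting t (UV.compression {x} {y} F) := by
  -- The case of one new and one old member.
  have mixed : ∀ A B : Finset V, x ∈ A → y ∉ A → insert y (A.erase x) ∈ F → B ∈ F →
      (x ∉ B → y ∈ B → insert x (B.erase y) ∈ F) → t ≤ #(A ∩ B) := by
    intro A B hxA hyA hA hB hB'
    by_cases hyB : y ∈ B
    · by_cases hxB : x ∈ B
      · have h : A ∩ B = insert x ((insert y (A.erase x) ∩ B).erase y) := by
          ext v; simp only [mem_inter, mem_insert, mem_erase]; grind
        have h1 : y ∈ insert y (A.erase x) ∩ B := by simp [hyB]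
        have h2 : x ∉ (insert y (A.erase x) ∩ B).erase y := by
          simp only [mem_inter, mem_insert, mem_erase]; grind
        rw [h, card_insert_of_notMem h2, card_erase_add_one h1]
        exact hF _ hA _ hB
      · refine (hF _ hA _ (hB' hxB hyB)).trans (card_le_card ?_)
        intro v; simp only [mem_inter, mem_insert, mem_erase]; grind
    · refine (hF _ hA _ hB).trans (card_le_card ?_)
      intro v; simp only [mem_inter, mem_insert, mem_erase]; grind
  intro A hA B hB
  rw [mem_compression_singleton] at hA hB
  obtain ⟨hA, hA'⟩ | ⟨-, hxA, hyA, hA⟩ := hA <;> obtain ⟨hB, hB'⟩ | ⟨-, hxB, hyB, hB⟩ := hB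
  · exact hF A hA B hB
  · rw [inter_comm]; exact mixed B A hxB hyB hB hA hA'
  · exact mixed A B hxA hyA hA hB hB'
  · have h : A ∩ B = insert x ((insert y (A.erase x) ∩ insert y (B.erase x)).erase y) := by
      ext v; simp only [mem_inter, mem_insert, mem_erase]; grind
    have h1 : y ∈ insert y (A.erase x) ∩ insert y (B.erase x) := by simp
    have h2 : x ∉ (insert y (A.erase x) ∩ insert y (B.erase x)).erase y := by
      simp only [mem_inter, mem_insert, mem_erase]; grind
    rw [h, card_insert_of_notMem h2, card_erase_add_one h1]
    exact hF _ hA _ hB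

/-- The total weight of a family, when the element `v` of the ground set has weight `e v`. -/
def totalWeight (e : V → ℕ) (F : Finset (Finset V)) : ℕ :=
  ∑ A ∈ F, ∑ v ∈ A, e v

lemma totalWeight_compression_lt {e : V → ℕ} {F : Finset (Finset V)} {x y : V}
    (hxy : e x < e y) {A : Finset V} (hA : A ∈ F) (hyA : y ∈ A) (hxA : x ∉ A)
    (hA' : insert x (A.erase y) ∉ F) :
    totalWeight e (UV.compression {x} {y} F) < totalWeight e F := by
  have hne : x ≠ y := fun h => hxA (h ▸ hyA)
  -- The sets that get replaced are matched with their replacements.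
  set P : Finset V → Prop := fun B => x ∉ B ∧ y ∈ B ∧ insert x (B.erase y) ∉ F with hP
  have hw : ∀ B : Finset V, P B → ∑ v ∈ insert x (B.erase y), e v < ∑ v ∈ B, e v := by
    rintro B ⟨h1, h2, -⟩
    rw [sum_insert (by simp [h1]), ← add_sum_erase B e h2]
    omega
  have hC : UV.compression {x} {y} F =
      F.filter (fun B => ¬ P B) ∪ (F.filter P).image (fun B => insert x (B.erase y)) := by
    ext B
    rw [mem_compression_singleton]
    simp only [mem_union, mem_filter, mem_image, hP]
    constructor
    · rintro (⟨h, h'⟩ | ⟨h, h1, h2, h3⟩)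
      · left; exact ⟨h, fun hh => hh.2.2 (h' hh.1 hh.2.1)⟩
      · right
        have : insert x ((insert y (B.erase x)).erase y) = B := by
          ext v; simp only [mem_insert, mem_erase]; grind
        exact ⟨_, ⟨h3, by simp [hne], by simp, by rwa [this]⟩, this⟩
    · rintro (⟨h, h'⟩ | ⟨D, ⟨hD, h1, h2, h3⟩, rfl⟩)
      · left; exact ⟨h, fun hh1 hh2 => by_contra fun hh => h' ⟨hh1, hh2, hh⟩⟩
      · right
        have : insert y ((insert x (D.erase y)).erase x) = D := by
          ext v; simp only [mem_insert, mem_erase]; grind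
        exact ⟨h3, by simp, by simp [hne.symm], by rwa [this]⟩
  have hinj : Set.InjOn (fun B => insert x (B.erase y)) (F.filter P : Set (Finset V)) := by
    intro B hB D hD h
    simp only [coe_filter, Set.mem_ofPred_eq, hP] at hB hD
    ext v
    have := Finset.ext_iff.1 h v
    simp only [mem_insert, mem_erase] at this
    grind
  calc totalWeight e (UV.compression {x} {y} F)
      ≤ ∑ B ∈ F.filter (fun B => ¬ P B), ∑ v ∈ B, e v
        + ∑ B ∈ F.filter P, ∑ v ∈ insert x (B.erase y), e v := by
        unfold totalWeight
        rw [hC, ← sum_image (f := fun B => ∑ v ∈ B, e v) hinj]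
        exact sum_union_inter (f := fun B => ∑ v ∈ B, e v) ▸ Nat.le_add_right _ _
    _ < ∑ B ∈ F.filter (fun B => ¬ P B), ∑ v ∈ B, e v + ∑ B ∈ F.filter P, ∑ v ∈ B, e v := by
        gcongr 1
        refine sum_lt_sum_of_nonempty ⟨A, ?_⟩ fun B hB => hw B (mem_filter.1 hB).2
        exact mem_filter.2 ⟨hA, hxA, hyA, hA'⟩
    _ = totalWeight e F := by
        rw [add_comm]; exact sum_filter_add_sum_filter_not F P _

end Compression

/-! ### Compression of largest `t`-intersecting families -/

section LargestCompression

variable {V : Type*} [Fintype V] [DecidableEq V] {p : ℕ} {X : Fin p → Finset V}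
  {R : Finset (Fin p → ℕ)}

lemma IsLargestTIntersecting.compression (hX : IsPartitionInto X) {t : ℕ}
    {F : Finset (Finset V)} (hF : IsLargestTIntersecting t (katonaFamily X R) F)
    {x y : V} {i : Fin p} (hx : x ∈ X i) (hy : y ∈ X i) :
    IsLargestTIntersecting t (katonaFamily X R) (UV.compression {x} {y} F) := by
  refine ⟨fun A hA => ?_, hF.2.1.compression x y, fun G hG hG' => ?_⟩
  · obtain ⟨hA, -⟩ | ⟨-, hxA, hyA, hA⟩ := mem_compression_singleton.1 hA
    · exact hF.1 hA
    · have hne : x ≠ y := fun h => hyA (h ▸ hxA)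
      have h := exchange_mem_katonaFamily (A := insert y (A.erase x)) hX hx hy (by simp)
        (by simp [hne]) (hF.1 hA)
      have : insert x ((insert y (A.erase x)).erase y) = A := by
        ext v; simp only [mem_insert, mem_erase]; grind
      rwa [this] at h
  · rw [UV.card_compression]
    exact hF.2.2 G hG hG'

/-- Compression does not create stars: if the compressed family is a full star, then so is the
family itself. -/
lemma isFullStar_of_compression (hX : IsPartitionInto X) {t b : ℕ} (hR : R.Nonempty)
    (hb : ∀ r ∈ R, ∀ i, r i ≤ b) (ht : ∀ r ∈ R, ∀ i, t ≤ r i) (hn : ∀ i, 3 * b ≤ #(X i))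
    {F : Finset (Finset V)} (hF : IsLargestTIntersecting t (katonaFamily X R) F)
    {x y : V} (hS : IsFullStar t (katonaFamily X R) (UV.compression {x} {y} F)) :
    IsFullStar t (katonaFamily X R) F := by
  obtain ⟨T, hT, hS⟩ := hS
  change _ = fullStar _ _ at hS
  have hcard : #F = #(fullStar (katonaFamily X R) T) := by rw [← hS, UV.card_compression]
  have star_of : (∀ A ∈ F, T ⊆ A) → IsFullStar t (katonaFamily X R) F := fun h =>
    ⟨T, hT, hF.eq_fullStar hT h⟩
  have hmem : ∀ A ∈ F, T ⊆ A ∨ (x ∉ A ∧ y ∈ A ∧ T ⊆ insert x (A.erase y)) := by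
    intro A hA
    by_cases h : x ∉ A ∧ y ∈ A ∧ insert x (A.erase y) ∉ F
    · right
      have hne : x ≠ y := fun hh => h.1 (hh ▸ h.2.1)
      have : insert x (A.erase y) ∈ UV.compression {x} {y} F := by
        rw [mem_compression_singleton]
        right
        have : insert y ((insert x (A.erase y)).erase x) = A := by
          ext v; simp only [mem_insert, mem_erase]; grind
        exact ⟨h.2.2, by simp, by simp [hne.symm], by rwa [this]⟩
      rw [hS] at this
      exact ⟨h.1, h.2.1, (mem_fullStar.1 this).2⟩
    · left
      have : A ∈ UV.compression {x} {y} F := by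
        rw [mem_compression_singleton]
        left
        exact ⟨hA, fun h1 h2 => by_contra fun h3 => h ⟨h1, h2, h3⟩⟩
      rw [hS] at this
      exact (mem_fullStar.1 this).2
  by_cases hxT : x ∈ T; swap
  · refine star_of fun A hA => ?_
    obtain h | ⟨-, -, h⟩ := hmem A hA
    · exact h
    · intro v hv
      have := h hv
      simp only [mem_insert, mem_erase] at this
      grind
  by_cases hyT : y ∈ T
  · refine star_of fun A hA => ?_
    obtain h | ⟨h1, h2, h⟩ := hmem A hA
    · exact h
    · have := h hyT
      simp only [mem_insert, mem_erase] at this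
      grind
  set T' := insert y (T.erase x) with hT'
  have hxy : x ≠ y := fun h => hyT (h ▸ hxT)
  have hT'card : #T' = t := by
    rw [hT', card_insert_of_notMem (by simp [hyT]), card_erase_add_one hxT, hT]
  have hmem' : ∀ A ∈ F, T ⊆ A ∨ (x ∉ A ∧ T' ⊆ A) := by
    intro A hA
    refine (hmem A hA).imp_right fun ⟨h1, h2, h3⟩ => ⟨h1, fun v hv => ?_⟩
    have h4 := @h3 v
    simp only [hT', mem_insert, mem_erase] at hv h4
    grind
  by_cases h1 : ∀ A ∈ F, T ⊆ A
  · exact star_of h1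
  by_cases h2 : ∀ A ∈ F, T' ⊆ A
  · exact ⟨T', hT'card, hF.eq_fullStar hT'card h2⟩
  -- Otherwise some `A ∈ F` contains `T` but not `y`, and some `B ∈ F` contains `T'` but not `x`.
  -- Neither a member `C ⊇ T` of `H` with `C ∩ (A ∪ B) = T` nor its exchange can belong to `F`.
  exfalso
  push Not at h1 h2
  obtain ⟨B, hB, hTB⟩ := h1
  obtain ⟨A, hA, hTA⟩ := h2
  obtain ⟨hxB, hT'B⟩ := (hmem' B hB).resolve_left hTB
  have hTA' : T ⊆ A := by
    obtain h | ⟨-, h⟩ := hmem' A hA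
    · exact h
    · exact absurd h hTA
  have hyA : y ∉ A := by
    intro h
    apply hTA
    intro v hv
    simp only [hT', mem_insert, mem_erase] at hv
    grind
  have hyB : y ∈ B := hT'B (mem_insert_self _ _)
  obtain ⟨r, hr⟩ := hR
  have hAb : ∀ j, ∀ D ∈ F, #(D ∩ X j) ≤ b := fun j D hD =>
    hb _ (mem_katonaFamily.1 (hF.1 hD)) j
  obtain ⟨C, hC, hTC, hCU⟩ := exists_mem_katonaFamily_superset (U := A ∪ B) (T := T) hX hr
    (fun j => ((card_le_card inter_subset_left).trans hT.le).trans (ht r hr j)) (by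
      intro j
      have h3 : #((A ∪ B) ∩ X j) ≤ #(A ∩ X j) + #(B ∩ X j) := by
        rw [union_inter_distrib_right]; exact card_union_le _ _
      have := hAb j A hA; have := hAb j B hB; have := hb r hr j; have := hn j
      omega)
  have hsmall : #(T.erase x) < t := by
    rw [card_erase_of_mem hxT]
    have : 0 < #T := card_pos.2 ⟨x, hxT⟩
    omega
  have hCS : C ∈ UV.compression {x} {y} F := by rw [hS]; exact mem_fullStar.2 ⟨hC, hTC⟩
  have hCv : ∀ v ∈ C, v ∈ A ∨ v ∈ B → v ∈ T := fun v hv h =>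
    hCU (mem_inter.2 ⟨hv, mem_union.2 h⟩)
  obtain ⟨hCF, -⟩ | ⟨-, -, -, hCF⟩ := mem_compression_singleton.1 hCS
  · refine absurd (hF.2.1 C hCF B hB) (not_le.2 (lt_of_le_of_lt (card_le_card ?_) hsmall))
    intro v hv
    simp only [mem_inter, mem_erase] at hv ⊢
    grind
  · refine absurd (hF.2.1 _ hCF A hA) (not_le.2 (lt_of_le_of_lt (card_le_card ?_) hsmall))
    intro v hv
    simp only [mem_inter, mem_erase, mem_insert] at hv ⊢
    grind

end LargestCompression

/-! ### The head of the parts -/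

section Head

variable {V : Type*} [DecidableEq V] {p : ℕ}

/-- The head of the parts: all elements which are preceded by fewer than `m` elements of their own
part, in the order given by `e`. -/
def head [Fintype V] (X : Fin p → Finset V) (e : V → ℕ) (m : ℕ) : Finset V :=
  univ.filter fun v => ∃ i, v ∈ X i ∧ #((X i).filter fun u => e u < e v) < m

lemma card_head_le [Fintype V] (X : Fin p → Finset V) {e : V → ℕ} (he : e.Injective) (m : ℕ) :
    #(head X e m) ≤ p * m := by
  have h : head X e m ⊆ univ.biUnion fun i =>
      (X i).filter fun v => #((X i).filter fun u => e u < e v) < m := by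
    intro v hv
    obtain ⟨i, hi⟩ := (mem_filter.1 hv).2
    exact mem_biUnion.2 ⟨i, mem_univ i, mem_filter.2 hi⟩
  refine (card_le_card h).trans (card_biUnion_le.trans ?_)
  have key : ∀ i ∈ (univ : Finset (Fin p)),
      #((X i).filter fun v => #((X i).filter fun u => e u < e v) < m) ≤ m := by
    intro i _
    conv_rhs => rw [← card_range m]
    -- Distinct elements of a part have distinct numbers of predecessors.
    refine card_le_card_of_injOn (fun v => #((X i).filter fun u => e u < e v)) ?_ ?_
    · intro v hv
      simpa using (mem_filter.1 hv).2
    · have hlt : ∀ v ∈ X i, ∀ w, e v < e w →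
          #((X i).filter fun u => e u < e v) < #((X i).filter fun u => e u < e w) := by
        intro v hv w hvw
        refine card_lt_card ((ssubset_iff_of_subset ?_).2 ⟨v, ?_, ?_⟩)
        · intro u hu
          rw [mem_filter] at hu ⊢
          exact ⟨hu.1, hu.2.trans hvw⟩
        · exact mem_filter.2 ⟨hv, hvw⟩
        · simp
      intro v hv w hw hvw
      have hv := (mem_filter.1 hv).1
      have hw := (mem_filter.1 hw).1
      simp only at hvw
      rcases lt_trichotomy (e v) (e w) with h | h | h
      · have := hlt v hv w h; omega
      · exact he h
      · have := hlt w hw v h; omega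
  simpa using sum_le_card_nsmul _ _ _ key

/-- In a shifted `t`-intersecting family, any two members already meet in `t` elements of the head:
a common element outside of the head can be exchanged, in one of the two sets, for an earlier
element that belongs to neither of them. -/
lemma le_card_inter_inter_head [Fintype V] {X : Fin p → Finset V} (hX : IsPartitionInto X)
    {t b : ℕ} {e : V → ℕ} {F : Finset (Finset V)} (hF : IsTIntersecting t F)
    (hb : ∀ A ∈ F, ∀ i, #(A ∩ X i) ≤ b)
    (hshift : ∀ i, ∀ x ∈ X i, ∀ y ∈ X i, e x < e y → ∀ A ∈ F, y ∈ A → x ∉ A →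
      insert x (A.erase y) ∈ F) {A B : Finset V} (hA : A ∈ F) (hB : B ∈ F) :
    t ≤ #(A ∩ B ∩ head X e (2 * b)) := by
  induction hk : #((A ∩ B) \ head X e (2 * b)) generalizing A with
  | zero =>
    have := hF A hA B hB
    have := card_sdiff_add_card_inter (A ∩ B) (head X e (2 * b))
    omega
  | succ k ih =>
    obtain ⟨y, hy⟩ := card_pos.1 (by omega : 0 < #((A ∩ B) \ head X e (2 * b)))
    have hy' := hy
    rw [mem_sdiff, mem_inter] at hy'
    obtain ⟨⟨hyA, hyB⟩, hyY⟩ := hy'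
    obtain ⟨i, hi⟩ := hX.2 y
    have hrank : 2 * b ≤ #((X i).filter fun u => e u < e y) := by
      by_contra h
      exact hyY (mem_filter.2 ⟨mem_univ y, i, hi, by omega⟩)
    obtain ⟨x, hx, hxAB⟩ : ∃ x ∈ (X i).filter (fun u => e u < e y), x ∉ A ∪ B := by
      by_contra! h
      have hsub : insert y ((X i).filter fun u => e u < e y) ⊆ (A ∩ X i) ∪ ((B ∩ X i).erase y) := by
        intro v hv
        rw [mem_insert] at hv
        obtain rfl | hv := hv
        · exact mem_union_left _ (mem_inter.2 ⟨hyA, hi⟩)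
        · have h1 := h v hv
          rw [mem_filter] at hv
          have : v ≠ y := by rintro rfl; exact lt_irrefl _ hv.2
          simp only [mem_union, mem_inter, mem_erase] at h1 ⊢
          tauto
      have h1 := (card_le_card hsub).trans (card_union_le _ _)
      rw [card_insert_of_notMem (by simp), card_erase_of_mem (mem_inter.2 ⟨hyB, hi⟩)] at h1
      have := hb A hA i
      have := hb B hB i
      omega
    rw [mem_filter] at hx
    rw [mem_union, not_or] at hxAB
    have hA' := hshift i x hx.1 y hi hx.2 A hA hyA hxAB.1
    have h1 : (insert x (A.erase y) ∩ B) \ head X e (2 * b) =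
        ((A ∩ B) \ head X e (2 * b)).erase y := by
      ext v; simp only [mem_sdiff, mem_inter, mem_insert, mem_erase]; grind
    have h2 : insert x (A.erase y) ∩ B ∩ head X e (2 * b) = A ∩ B ∩ head X e (2 * b) := by
      ext v; simp only [mem_inter, mem_insert, mem_erase]; grind
    rw [← h2]
    refine ih hA' ?_
    rw [h1, card_erase_of_mem hy, hk]
    rfl

end Head

/-! ### Covering by stars -/

section Bound

variable {V : Type*} [DecidableEq V]

/-- If all members of `F` meet `Y` in at least `t + j` elements, of which at least `t` lie in the
set `S`, then `F` is covered by the stars of the `(t + j)`-subsets of `Y` meeting `S` in at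
least `t` elements. -/
lemma card_le_choose_mul_choose_mul {H F : Finset (Finset V)} (hFH : F ⊆ H) {S Y : Finset V}
    {t j m : ℕ} (hS : ∀ B ∈ F, t ≤ #(B ∩ S)) (hSY : S ⊆ Y) (hY : ∀ B ∈ F, t + j ≤ #(B ∩ Y))
    (hm : ∀ W : Finset V, #W = t + j → #(fullStar H W) ≤ m) :
    #F ≤ (#S).choose t * (#Y).choose j * m := by
  have hcover : F ⊆ ((S.powersetCard t ×ˢ Y.powersetCard j).filter
      fun q => Disjoint q.1 q.2).biUnion fun q => fullStar H (q.1 ∪ q.2) := by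
    intro B hB
    obtain ⟨P, hP, hPt⟩ := exists_subset_card_eq (hS B hB)
    have hPY : P ⊆ B ∩ Y := hP.trans (inter_subset_inter_left hSY)
    obtain ⟨Q, hQ, hQj⟩ := exists_subset_card_eq (s := (B ∩ Y) \ P) (n := j) (by
      rw [card_sdiff_of_subset hPY]
      have := hY B hB
      omega)
    refine mem_biUnion.2 ⟨(P, Q), mem_filter.2 ⟨mem_product.2 ⟨?_, ?_⟩, ?_⟩, ?_⟩
    · exact mem_powersetCard.2 ⟨hP.trans inter_subset_right, hPt⟩
    · exact mem_powersetCard.2 ⟨(hQ.trans sdiff_subset).trans inter_subset_right, hQj⟩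
    · exact disjoint_sdiff.mono_right hQ
    · exact mem_fullStar.2 ⟨hFH hB, union_subset (hP.trans inter_subset_left)
        ((hQ.trans sdiff_subset).trans inter_subset_left)⟩
  calc #F ≤ _ := card_le_card hcover
    _ ≤ ∑ q ∈ (S.powersetCard t ×ˢ Y.powersetCard j).filter fun q => Disjoint q.1 q.2,
        #(fullStar H (q.1 ∪ q.2)) := card_biUnion_le
    _ ≤ #((S.powersetCard t ×ˢ Y.powersetCard j).filter fun q => Disjoint q.1 q.2) • m := by
        refine sum_le_card_nsmul _ _ _ fun q hq => hm _ ?_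
        simp only [mem_filter, mem_product, mem_powersetCard] at hq
        rw [card_union_of_disjoint hq.2, hq.1.1.2, hq.1.2.2]
    _ ≤ #(S.powersetCard t ×ˢ Y.powersetCard j) • m := by
        gcongr
        exact filter_subset _ _
    _ = (#S).choose t * (#Y).choose j * m := by
        rw [card_product, card_powersetCard, card_powersetCard, smul_eq_mul]

lemma choose_add_le_pow (t j : ℕ) : (t + j).choose t ≤ (t + 1) ^ j := by
  induction j with
  | zero => simp
  | succ j ih =>
    have h := Nat.add_one_mul_choose_eq (t + j) j
    rw [Nat.choose_symm_add] at ih ⊢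
    have hle : (t + (j + 1)).choose (j + 1) * (j + 1) ≤ (t + 1) ^ (j + 1) * (j + 1) := by
      rw [← add_assoc, ← h, pow_succ, mul_assoc, mul_comm (t + j + 1)]
      exact Nat.mul_le_mul ih (by nlinarith [Nat.zero_le (t * j)])
    exact Nat.le_of_mul_le_mul_right hle (Nat.succ_pos j)

end Bound

/-! ### Shifted families and the conclusion -/

section Shifted

variable {V : Type*} [Fintype V] [DecidableEq V] {p : ℕ} {X : Fin p → Finset V}
  {R : Finset (Fin p → ℕ)}

/-- The theorem for families that are shifted within each part. -/
lemma isFullStar_of_shifted (hX : IsPartitionInto X) (hp : 1 ≤ p) {t b : ℕ} (hR : R.Nonempty)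
    (hb : ∀ r ∈ R, ∀ i, r i ≤ b) (ht : ∀ r ∈ R, ∀ i, t ≤ r i) (htb : t ≤ b)
    (hn : ∀ i, 2 * (t + 1) * p * b ^ (t + 2) < #(X i)) (hbX : ∀ i, b ≤ #(X i))
    {F : Finset (Finset V)} (hF : IsLargestTIntersecting t (katonaFamily X R) F)
    {e : V → ℕ} (he : e.Injective)
    (hshift : ∀ i, ∀ x ∈ X i, ∀ y ∈ X i, e x < e y → ∀ A ∈ F, y ∈ A → x ∉ A →
      insert x (A.erase y) ∈ F) :
    IsFullStar t (katonaFamily X R) F := by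
  set H := katonaFamily X R
  set Y := head X e (2 * b)
  have hFb : ∀ A ∈ F, ∀ i, #(A ∩ X i) ≤ b := fun A hA => hb _ (mem_katonaFamily.1 (hF.1 hA))
  have hAB : ∀ A ∈ F, ∀ B ∈ F, t ≤ #(A ∩ B ∩ Y) := fun A hA B hB =>
    le_card_inter_inter_head hX hF.2.1 hFb hshift hA hB
  have : Nonempty (Fin p) := ⟨⟨0, hp⟩⟩
  obtain ⟨i, hi⟩ := Finite.exists_min fun i => #(X i)
  set n := #(X i)
  -- A star centred in the smallest part bounds `#F` from below.
  obtain ⟨T, hTX, hT⟩ := exists_subset_card_eq (htb.trans (hbX i))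
  have hHF : #H ≤ n ^ t * #F := by
    refine (card_katonaFamily_le hX ht hTX hT.le).trans ?_
    rw [hT]
    exact Nat.mul_le_mul_left _
      (hF.2.2 _ (filter_subset _ _) (hT ▸ isTIntersecting_fullStar H T))
  have hHpos : 0 < #H := by
    obtain ⟨r, hr⟩ := hR
    obtain ⟨C, hC, -⟩ := exists_mem_katonaFamily_superset (T := ∅) (U := ∅) hX hr (by simp)
      (fun i => by simpa using (hb r hr i).trans (hbX i))
    exact card_pos.2 ⟨C, hC⟩
  have hFpos : 0 < #F := Nat.pos_of_ne_zero fun h => by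
    rw [h, mul_zero] at hHF; omega
  obtain ⟨A, hA, hAmin⟩ := exists_min_image F (fun A => #(A ∩ Y)) (card_pos.1 hFpos)
  have htA : t ≤ #(A ∩ Y) := by simpa using hAB A hA A hA
  obtain ⟨j, hj⟩ := Nat.exists_eq_add_of_le htA
  obtain rfl | hj0 := j.eq_zero_or_pos
  · refine ⟨A ∩ Y, hj, hF.eq_fullStar hj fun B hB => ?_⟩
    have hsub : A ∩ B ∩ Y ⊆ A ∩ Y := inter_subset_inter_right inter_subset_left
    rw [← eq_of_subset_of_card_le hsub (by rw [hj]; exact hAB A hA B hB)]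
    exact inter_subset_left.trans inter_subset_right
  exfalso
  have hS : ∀ B ∈ F, t ≤ #(B ∩ (A ∩ Y)) := fun B hB => by
    have := hAB A hA B hB
    rwa [inter_comm A B, inter_assoc] at this
  have hYF : ∀ B ∈ F, t + j ≤ #(B ∩ Y) := fun B hB => hj ▸ hAmin B hB
  have hYcard : #Y ≤ p * (2 * b) := card_head_le X he (2 * b)
  have hn0 : 0 < n := by have := hn i; omega
  have hstar : ∀ W : Finset V, #W = t + j →
      #(fullStar H W) ≤ b ^ (t + j) * #H / n ^ (t + j) := fun W hW => by
    rw [Nat.le_div_iff_mul_le (pow_pos hn0 _), mul_comm, ← hW]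
    exact pow_mul_card_fullStar_le hX hb hbX hi W
  have hcount := card_le_choose_mul_choose_mul hF.1 hS inter_subset_right hYF hstar
  rw [hj] at hcount
  have hchoose : (#Y).choose j ≤ (p * (2 * b)) ^ j :=
    (Nat.choose_le_pow _ _).trans (Nat.pow_le_pow_left hYcard j)
  have h1 : #F * n ^ (t + j) ≤ (t + 1) ^ j * (p * (2 * b)) ^ j * (b ^ (t + j) * (n ^ t * #F)) := by
    calc #F * n ^ (t + j)
        ≤ (t + j).choose t * (#Y).choose j * (b ^ (t + j) * #H / n ^ (t + j)) * n ^ (t + j) := by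
          gcongr
      _ = (t + j).choose t * (#Y).choose j * (b ^ (t + j) * #H / n ^ (t + j) * n ^ (t + j)) := by
          ring
      _ ≤ (t + 1) ^ j * (p * (2 * b)) ^ j * (b ^ (t + j) * (n ^ t * #F)) := by
          exact Nat.mul_le_mul (Nat.mul_le_mul (choose_add_le_pow t j) hchoose)
            ((Nat.div_mul_le_self _ _).trans (Nat.mul_le_mul_left _ hHF))
  have h2 : n ^ j ≤ (2 * (t + 1) * p * b ^ 2) ^ j * b ^ t := by
    have h3 : n ^ j * (#F * n ^ t) ≤ (2 * (t + 1) * p * b ^ 2) ^ j * b ^ t * (#F * n ^ t) := by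
      calc n ^ j * (#F * n ^ t) = #F * n ^ (t + j) := by ring
        _ ≤ _ := h1
        _ = _ := by simp only [mul_pow, pow_add]; ring
    exact Nat.le_of_mul_le_mul_right h3 (by positivity)
  have h4 : (2 * (t + 1) * p * b ^ 2) ^ j * b ^ t ≤ (2 * (t + 1) * p * b ^ (t + 2)) ^ j := by
    calc (2 * (t + 1) * p * b ^ 2) ^ j * b ^ t
        ≤ (2 * (t + 1) * p * b ^ 2) ^ j * (b ^ t) ^ j := by
          exact Nat.mul_le_mul_left _ (Nat.le_self_pow hj0.ne' _)
      _ = (2 * (t + 1) * p * b ^ (t + 2)) ^ j := by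
          rw [← mul_pow, mul_assoc _ (b ^ 2), ← pow_add, add_comm 2 t]
  exact absurd (h2.trans h4) (not_le.2 (Nat.pow_lt_pow_left (hn i) hj0.ne'))

/-- Shifting within the parts reduces the theorem to shifted families. -/
lemma isFullStar_of_isLargestTIntersecting (hX : IsPartitionInto X) (hp : 1 ≤ p) {t b : ℕ}
    (hR : R.Nonempty) (hb : ∀ r ∈ R, ∀ i, r i ≤ b) (ht : ∀ r ∈ R, ∀ i, t ≤ r i)
    (htb : t ≤ b) (hn : ∀ i, 2 * (t + 1) * p * b ^ (t + 2) < #(X i)) (hbX : ∀ i, 3 * b ≤ #(X i))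
    {e : V → ℕ} (he : e.Injective) (F : Finset (Finset V))
    (hF : IsLargestTIntersecting t (katonaFamily X R) F) :
    IsFullStar t (katonaFamily X R) F := by
  induction hw : totalWeight e F using Nat.strong_induction_on generalizing F with
  | _ w ih =>
    by_cases hshift : ∀ i, ∀ x ∈ X i, ∀ y ∈ X i, e x < e y → ∀ A ∈ F, y ∈ A → x ∉ A →
        insert x (A.erase y) ∈ F
    · exact isFullStar_of_shifted hX hp hR hb ht htb hn
        (fun i => by have := hbX i; omega) hF he hshift
    · push Not at hshift
      obtain ⟨i, x, hx, y, hy, hxy, A, hA, hyA, hxA, hA'⟩ := hshift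
      exact isFullStar_of_compression hX hR hb ht hbX hF
        (ih _ (hw ▸ totalWeight_compression_lt hxy hA hyA hxA hA') _
          (hF.compression hX hx hy) rfl)

end Shifted

theorem theorem1p4 {V : Type*} [Fintype V] [DecidableEq V] (p t b c : ℕ)
    (hp : 1 ≤ p) (ht : 1 ≤ t)
    (X : Fin p → Finset V) (hX : IsPartitionInto X)
    (R : Finset (Fin p → ℕ)) (hR : R.Nonempty) (hpos : ∀ r ∈ R, ∀ i, 0 < r i)
    (hb : IsGreatest (entries R) b) (hc : IsLeast (entries R) c)
    (htc : t ≤ c) (hn : ∀ i, 2 * (t + 1) * p * b ^ (t + 2) < (X i).card)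
    (F : Finset (Finset V)) (hF : IsLargestTIntersecting t (katonaFamily X R) F) :
    IsTrivialFamily t F ∧ IsFullStar t (katonaFamily X R) F := by
  have hrb : ∀ r ∈ R, ∀ i, r i ≤ b := fun r hr i => hb.2 ⟨r, hr, i, rfl⟩
  have htr : ∀ r ∈ R, ∀ i, t ≤ r i := fun r hr i => htc.trans (hc.2 ⟨r, hr, i, rfl⟩)
  have htb : t ≤ b := htc.trans (hc.2 hb.1)
  have hb1 : 1 ≤ b := ht.trans htb
  have hbX : ∀ i, 3 * b ≤ #(X i) := fun i => by
    have h1 : b ≤ b ^ (t + 2) := Nat.le_self_pow (by omega) b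
    have h2 : 3 * 1 ≤ 2 * (t + 1) * p := Nat.le_trans (by omega) (Nat.le_mul_of_pos_right _ hp)
    exact (Nat.mul_le_mul (by omega) h1).trans (hn i).le
  have hstar : IsFullStar t (katonaFamily X R) F :=
    isFullStar_of_isLargestTIntersecting hX hp hR hrb htr htb hn hbX
      (e := fun v => (Fintype.equivFin V v : ℕ))
      (Fin.val_injective.comp (Fintype.equivFin V).injective) F hF
  refine ⟨?_, hstar⟩
  obtain ⟨T, hT, rfl⟩ := hstar
  exact ⟨T, hT, fun A hA => (mem_filter.1 hA).2⟩
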